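/- Let $n\ge 0$ be an integer and let $A,B$ be complex $n\times n$ matrices. For a complex $n\times n$ matrix $M$ let $\Sigma(M)$ denote the multiset of its $n$ eigenvalues, repeated according to algebraic multiplicity. A matrix path from $A$ to $B$ is a continuous map $\mathcal{C}:[0,1]\to M_n(\mathbb{C})$, $\alpha\mapsto\mathcal{C}_\alpha$, with $\mathcal{C}_0=A$ and $\mathcal{C}_1=B$. A $\mathcal{C}$-eigenpath set consists of $n$ continuous functions $\gamma_1,\dots,\gamma_n:[0,1]\to\mathbb{C}$, not necessarily distinct, such that $\Sigma(\mathcal{C}_\alpha)=\{\gamma_1(\alpha),\dots,\gamma_n(\alpha)\}$ as multisets for every $\alpha\in[0,1]$. A $\mathcal{C}$-eigenpairing is a bijection $p:\Sigma(A)\to\Sigma(B)$ that is induced by some $\mathcal{C}$-eigenpath set via $\gamma_j(0)\mapsto\gamma_j(1)$ for $j=1,\dots,n$; here different occurrences of a repeated eigenvalue are regarded as different elements of the multiset, and may be assigned in any way to the paths starting (respectively ending) at that eigenvalue. A convex eigenpairing is a $C$-eigenpairing for the convex path $C_\alpha=(1-\alpha)A+\alpha B$. Let $f,g:[0,1]\to\mathbb{R}$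 be continuous functions with $f(0)=g(1)=1$ and $f(1)=g(0)=0$, so that $\mathcal{C}_\alpha=f(\alpha)A+g(\alpha)B$ is a matrix path from $A$ to $B$. If $\max(f(\alpha),g(\alpha))\ge 0$ for all $\alpha\in[0,1]$, then every convex eigenpairing $p:\Sigma(A)\to\Sigma(B)$ is also a $\mathcal{C}$-eigenpairing. -/

import Mathlib

open scoped unitInterval

noncomputable section

/-- The size-`n` multiset spectrum of a complex `n × n` matrix: its eigenvalues, repeated according
to algebraic multiplicity. -/
def multisetSpectrum {n : ℕ} (A : Matrix (Fin n) (Fin n) ℂ) : Multiset ℂ :=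
  A.charpoly.roots

/-- `γ 0, …, γ (n-1)` form an eigenpath set of the matrix path `C` (a continuous map on `[0,1]` with
values in the complex `n × n` matrices and `C 0 = A`, `C 1 = B`): at every parameter `α` the values
of these continuous functions are the eigenvalues of `C α`, as an equality of multisets. -/
def IsEigenpathSet {n : ℕ} {A B : Matrix (Fin n) (Fin n) ℂ} (C : Path A B)
    (γ : Fin n → C(I, ℂ)) : Prop :=
  ∀ α : I, multisetSpectrum (C α) = Finset.univ.val.map (fun j => γ j α)

/-- The bijection `p` from the eigenvalues of `A` to those of `B` is an eigenpairing for the matrix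
path `C`: it is induced by some eigenpath set `γ` through `γ j 0 ↦ γ j 1`. Different occurrences of
a repeated eigenvalue are different elements of the domain and of the codomain of `p` (the elements
of a multiset regarded as a type are its occurrences); `e j` is the occurrence of `γ j 0` at which
the path `γ j` starts, and `p (e j)` is the occurrence of `γ j 1` at which it ends. -/
def IsEigenpairing {n : ℕ} {A B : Matrix (Fin n) (Fin n) ℂ} (C : Path A B)
    (p : multisetSpectrum A ≃ multisetSpectrum B) : Prop :=
  ∃ γ : Fin n → C(I, ℂ), IsEigenpathSet C γ ∧
    ∃ e : Fin n ≃ multisetSpectrum A,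
      ∀ j : Fin n, γ j 0 = (e j : ℂ) ∧ γ j 1 = (p (e j) : ℂ)

/-- The matrix path `α ↦ f α • A + g α • B` from `A` to `B`. -/
def combinationPath {n : ℕ} (A B : Matrix (Fin n) (Fin n) ℂ) (f g : C(I, ℝ))
    (hf0 : f 0 = 1) (hg1 : g 1 = 1) (hf1 : f 1 = 0) (hg0 : g 0 = 0) : Path A B where
  toFun α := f α • A + g α • B
  continuous_toFun := by fun_prop
  source' := by simp [hf0, hg0]
  target' := by simp [hf1, hg1]

/-- The convex path `α ↦ (1 - α) • A + α • B` from `A` to `B`. -/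
def convexPath {n : ℕ} (A B : Matrix (Fin n) (Fin n) ℂ) : Path A B where
  toFun α := (1 - (α : ℝ)) • A + (α : ℝ) • B
  continuous_toFun := by fun_prop
  source' := by simp
  target' := by simp

end

open scoped unitInterval
open Filter Topology

/-! The hypothesis says that the curve `(f, g)` avoids the open third quadrant, so it suffices to
choose the eigenvalues of `u • A + v • B` continuously on the other three closed quadrants. On the
first, spectra scale linearly along rays, so the convex eigenpaths `c` extend homogeneously
(`homogeneousExtension`). The fourth is the cone on the segment from `A` to `-B`, the second the
cone on the segment from `B` to `-A`; eigenpaths there, started at `c j 0` and `c j 1`, agree with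
`c` on the shared rays. The glued functions, composed with `(f, g)`, keep the endpoints of `c` and
so induce the same `p`.

The analytic input is `exists_isEigenpathSet`: eigenvalue vectors, in all orderings, form finite
sets varying uniformly continuously, and such a family has a continuous selection, obtained as an
ultralimit of discrete chains. -/

/-! ### Continuous selections from finite-set-valued families -/

theorem dist_le_of_chain_near_finset {X : Type*} [PseudoMetricSpace X] {ρ ε : ℝ}
    (hρ : 0 ≤ ρ) (hε : 0 ≤ ε) (O : Finset X) :
    ∀ (m : ℕ) (x : ℕ → X), (∀ i < m, dist (x i) (x (i + 1)) ≤ ε) →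
      (∀ i ≤ m, ∃ o ∈ O, dist (x i) o ≤ ρ) → dist (x 0) (x m) ≤ O.card * (2 * ρ + ε) := by
  classical
  induction hN : O.card generalizing O with
  | zero =>
    intro m x _ h
    obtain ⟨o, ho, -⟩ := h 0 (Nat.zero_le _)
    simp [Finset.card_eq_zero.mp hN] at ho
  | succ N ih =>
    intro m x hstep hnear
    obtain ⟨o, ho, h0⟩ := hnear 0 (Nat.zero_le _)
    -- The last visit near `o`: up to `i` the net displacement is at most `2 * ρ`, and afterwards
    -- `o` can be erased from `O`.
    let i := Nat.findGreatest (fun i => dist (x i) o ≤ ρ) m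
    have him : i ≤ m := Nat.findGreatest_le m
    have hi : dist (x i) o ≤ ρ :=
      Nat.findGreatest_spec (P := fun i => dist (x i) o ≤ ρ) (Nat.zero_le m) h0
    have hlast : ∀ k, i < k → k ≤ m → ¬ dist (x k) o ≤ ρ :=
      fun k => Nat.findGreatest_is_greatest
    have h0i : dist (x 0) (x i) ≤ 2 * ρ := by
      linarith [dist_triangle_right (x 0) (x i) o]
    push_cast
    rcases him.eq_or_lt with h | h
    · rw [← h]
      nlinarith [mul_nonneg (Nat.cast_nonneg (α := ℝ) N) (by positivity : 0 ≤ 2 * ρ + ε)]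
    · have key := ih (O.erase o) (by rw [Finset.card_erase_of_mem ho, hN]; rfl)
        (m - (i + 1)) (fun k => x (i + 1 + k))
        (fun k hk => hstep (i + 1 + k) (by omega)) (fun k hk => by
          obtain ⟨o', ho', h'⟩ := hnear (i + 1 + k) (by omega)
          refine ⟨o', Finset.mem_erase.mpr ⟨?_, ho'⟩, h'⟩
          rintro rfl
          exact hlast (i + 1 + k) (by omega) (by omega) h')
      simp only [add_zero, Nat.add_sub_cancel' h] at key
      have := dist_triangle4 (x 0) (x i) (x (i + 1)) (x m)
      linarith [hstep i h]

theorem dist_le_of_chain_near_finset_of_mem_Icc {X : Type*} [PseudoMetricSpace X] {ρ ε : ℝ}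
    (hρ : 0 ≤ ρ) (hε : 0 ≤ ε) (O : Finset X) {a b : ℕ} (hab : a ≤ b) (x : ℕ → X)
    (hstep : ∀ i, a ≤ i → i < b → dist (x i) (x (i + 1)) ≤ ε)
    (hnear : ∀ i, a ≤ i → i ≤ b → ∃ o ∈ O, dist (x i) o ≤ ρ) :
    dist (x a) (x b) ≤ O.card * (2 * ρ + ε) := by
  have := dist_le_of_chain_near_finset hρ hε O (b - a) (fun i => x (a + i))
    (fun i hi => hstep (a + i) (by omega) (by omega))
    (fun i hi => hnear (a + i) (by omega) (by omega))
  simpa [Nat.add_sub_cancel' hab] using this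

/-- A uniformly Hausdorff-continuous family of finite sets over the unit interval has a
continuous selection through any point over `0`. -/
theorem exists_continuous_selection {X : Type*} [MetricSpace X] (R : I → Set X)
    (hfin : ∀ t, (R t).Finite)
    (hR : ∀ ε > 0, ∃ δ > 0, ∀ s t : I, dist s t < δ → ∀ x ∈ R s, ∃ y ∈ R t, dist x y < ε)
    {x₀ : X} (hx₀ : x₀ ∈ R 0) :
    ∃ γ : C(I, X), γ 0 = x₀ ∧ ∀ t, γ t ∈ R t := by
  let grid (M k : ℕ) : I := Set.projIcc 0 1 zero_le_one ((k : ℝ) / M)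
  have grid_dist (M : ℕ) (k : ℕ) (t : I) : dist (grid M k) t ≤ |(k : ℝ) / M - t| := by
    conv_lhs => rw [← Set.projIcc_val zero_le_one t]
    rw [Subtype.dist_eq, Real.dist_eq]
    exact Set.abs_projIcc_sub_projIcc zero_le_one
  have mesh : ∀ N : ℕ, ∃ M : ℕ, N < M ∧ ∀ k : ℕ, ∀ x ∈ R (grid M k),
      ∃ y ∈ R (grid M (k + 1)), dist x y < 1 / ((N : ℝ) + 1) := by
    intro N
    obtain ⟨δ, hδ, h⟩ := hR (1 / ((N : ℝ) + 1)) (by positivity)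
    obtain ⟨K, hK⟩ := exists_nat_gt (1 / δ)
    -- `K` makes the mesh finer than `δ`; `N` forces the mesh to tend to zero.
    refine ⟨N + K + 1, by omega, fun k => h _ _ ?_⟩
    have hM : (0 : ℝ) < (N + K + 1 : ℕ) := by positivity
    have : 1 / ((N + K + 1 : ℕ) : ℝ) < δ := by
      rw [div_lt_iff₀ hM]
      rw [div_lt_iff₀ hδ] at hK
      push_cast
      nlinarith [Nat.cast_nonneg (α := ℝ) N]
    refine lt_of_le_of_lt ?_ this
    rw [Subtype.dist_eq, Real.dist_eq]
    refine (Set.abs_projIcc_sub_projIcc zero_le_one).trans_eq ?_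
    push_cast
    rw [← sub_div, abs_div, abs_of_pos (by positivity : (0 : ℝ) < N + K + 1)]
    simp
  choose M hNM hM using mesh
  have chains : ∀ N, ∃ x : ℕ → X, x 0 = x₀ ∧ (∀ k, x k ∈ R (grid (M N) k)) ∧
      ∀ k, dist (x k) (x (k + 1)) < 1 / ((N : ℝ) + 1) := by
    intro N
    choose! next hnext hdist using hM N
    let x : ℕ → X := fun k => Nat.rec x₀ next k
    have hx : ∀ k, x k ∈ R (grid (M N) k) := by
      intro k
      induction k with
      | zero => simpa [x, grid] using hx₀
      | succ k ih => exact hnext k _ ih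
    exact ⟨x, rfl, hx, fun k => hdist k _ (hx k)⟩
  choose x hx0 hxR hxd using chains
  have hMpos (N : ℕ) : (0 : ℝ) < M N := by exact_mod_cast (Nat.zero_le N).trans_lt (hNM N)
  let idx (N : ℕ) (t : I) : ℕ := ⌊(t : ℝ) * M N⌋₊
  have idx_le (N : ℕ) (t : I) : (idx N t : ℝ) / M N ≤ t :=
    (div_le_iff₀ (hMpos N)).mpr (Nat.floor_le (mul_nonneg t.2.1 (hMpos N).le))
  have lt_idx (N : ℕ) (t : I) : (t : ℝ) < idx N t / M N + 1 / M N := by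
    rw [← add_div, lt_div_iff₀ (hMpos N)]
    exact Nat.lt_floor_add_one _
  have hMlim : Tendsto (fun N => 1 / (M N : ℝ)) atTop (𝓝 0) := by
    refine squeeze_zero (fun N => by positivity) (fun N => ?_)
      (tendsto_one_div_add_atTop_nhds_zero_nat (𝕜 := ℝ))
    exact one_div_le_one_div_of_le (by positivity) (by exact_mod_cast hNM N)
  -- One ultrafilter gives limits at all `t` simultaneously, with no subsequence to extract.
  let U : Ultrafilter ℕ := hyperfilter ℕ
  have hU : (U : Filter ℕ) ≤ atTop := Nat.hyperfilter_le_atTop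
  have lim : ∀ t : I, ∃ y ∈ R t, Tendsto (fun N => x N (idx N t)) U (𝓝 y) := by
    intro t
    have near : ∀ ε > 0, ∀ᶠ N in (U : Filter ℕ), ∃ y ∈ R t, dist (x N (idx N t)) y < ε := by
      intro ε hε
      obtain ⟨δ, hδ, h⟩ := hR ε hε
      filter_upwards [hU ((tendsto_order.mp hMlim).2 δ hδ)] with N hN
      refine h _ _ ((grid_dist _ _ _).trans_lt ?_) _ (hxR N _)
      rw [abs_lt]
      constructor <;> linarith [idx_le N t, lt_idx N t]
    -- Otherwise the chain values stay `U`-eventually away from every point of `R t`, uniformly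
    -- since `R t` is finite, contradicting `near`.
    by_contra! hcon
    have : ∀ y ∈ R t, ∃ ε > 0, ∀ᶠ N in (U : Filter ℕ), ε ≤ dist (x N (idx N t)) y := by
      intro y hy
      have := hcon y hy
      rw [Metric.tendsto_nhds] at this
      push Not at this
      obtain ⟨ε, hε, h⟩ := this
      exact ⟨ε, hε, h⟩
    choose! ε hε hfar using this
    obtain ⟨-, y₁, hy₁, -⟩ := (near 1 one_pos).exists
    obtain ⟨y₀, hy₀, hmin⟩ := Set.exists_min_image (R t) ε (hfin t) ⟨y₁, hy₁⟩
    have hall : ∀ᶠ N in (U : Filter ℕ), ∀ y ∈ R t, ε y ≤ dist (x N (idx N t)) y :=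
      (eventually_all_finite (hfin t)).mpr hfar
    obtain ⟨N, ⟨y, hy, h1⟩, h2⟩ := ((near (ε y₀) (hε y₀ hy₀)).and hall).exists
    linarith [h2 y hy, hmin y hy]
  choose γ hγR hγ using lim
  have h0 : γ 0 = x₀ := by
    refine tendsto_nhds_unique (hγ 0) ?_
    simp only [idx, Set.Icc.coe_zero, zero_mul, Nat.floor_zero, hx0]
    exact tendsto_const_nhds
  refine ⟨⟨γ, ?_⟩, h0, hγR⟩
  rw [Metric.continuous_iff]
  intro t ε hε
  let O := (hfin t).toFinset
  -- The chain bound with step `ρ` is `3 * O.card * ρ`; the extra `1` makes it strictly less than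
  -- `ε`.
  let ρ := ε / (3 * O.card + 1)
  have hρ : 0 < ρ := by positivity
  obtain ⟨δ, hδ, hδR⟩ := hR ρ hρ
  -- Half of `δ` is for `dist s t`, half for the mesh, so all grid points between `s` and `t` lie
  -- within `δ` of `t`.
  refine ⟨δ / 2, half_pos hδ, fun s hs => ?_⟩
  have hst := abs_lt.mp (by simpa [Subtype.dist_eq, Real.dist_eq] using hs : |(s : ℝ) - t| < δ / 2)
  have bound : ∀ᶠ N in (U : Filter ℕ),
      dist (x N (idx N s)) (x N (idx N t)) ≤ O.card * (2 * ρ + ρ) := by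
    filter_upwards [hU ((tendsto_order.mp hMlim).2 (δ / 2) (half_pos hδ)),
      hU ((tendsto_order.mp (tendsto_one_div_add_atTop_nhds_zero_nat (𝕜 := ℝ))).2 ρ hρ)]
      with N hN1 hN2
    have hstep (k : ℕ) : dist (x N k) (x N (k + 1)) ≤ ρ := ((hxd N k).trans hN2).le
    have hnear (k : ℕ) (h1 : min (idx N s) (idx N t) ≤ k) (h2 : k ≤ max (idx N s) (idx N t)) :
        ∃ o ∈ O, dist (x N k) o ≤ ρ := by
      have hlow : (t : ℝ) - δ < k / M N := by
        rcases min_le_iff.mp h1 with h | h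
        · have := div_le_div_of_nonneg_right (Nat.cast_le (α := ℝ).mpr h) (hMpos N).le
          linarith [lt_idx N s]
        · have := div_le_div_of_nonneg_right (Nat.cast_le (α := ℝ).mpr h) (hMpos N).le
          linarith [lt_idx N t]
      have hupp : (k : ℝ) / M N < t + δ := by
        rcases le_max_iff.mp h2 with h | h
        · have := div_le_div_of_nonneg_right (Nat.cast_le (α := ℝ).mpr h) (hMpos N).le
          linarith [idx_le N s]
        · have := div_le_div_of_nonneg_right (Nat.cast_le (α := ℝ).mpr h) (hMpos N).le
          linarith [idx_le N t]
      obtain ⟨o, ho, h⟩ := hδR (grid (M N) k) t ((grid_dist _ _ _).trans_lt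
        (abs_lt.mpr ⟨by linarith, by linarith⟩)) _ (hxR N k)
      exact ⟨o, (hfin t).mem_toFinset.mpr ho, h.le⟩
    rcases le_total (idx N s) (idx N t) with h | h
    · exact dist_le_of_chain_near_finset_of_mem_Icc hρ.le hρ.le O h (x N) (fun k _ _ => hstep k)
        (fun k h1 h2 => hnear k (by rwa [min_eq_left h]) (by rwa [max_eq_right h]))
    · rw [dist_comm]
      exact dist_le_of_chain_near_finset_of_mem_Icc hρ.le hρ.le O h (x N) (fun k _ _ => hstep k)
        (fun k h1 h2 => hnear k (by rwa [min_eq_right h]) (by rwa [max_eq_left h]))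
  have hle : dist (γ s) (γ t) ≤ O.card * (2 * ρ + ρ) :=
    le_of_tendsto ((hγ s).dist (hγ t)) bound
  refine hle.trans_lt ?_
  have : (3 * (O.card : ℝ) + 1) * ρ = ε := mul_div_cancel₀ _ (by positivity)
  linarith

/-! ### Continuity of eigenvalues and existence of eigenpaths -/

theorem exists_perm_comp_eq_of_map_univ_eq {ι X : Type*} [Fintype ι] {z w : ι → X}
    (h : Finset.univ.val.map z = Finset.univ.val.map w) :
    ∃ τ : Equiv.Perm ι, z = w ∘ τ := by
  classical
  have hcard (c : X) : Nonempty ({i // z i = c} ≃ {i // w i = c}) := by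
    rw [← Fintype.card_eq, Fintype.card_subtype, Fintype.card_subtype]
    have := congrArg (Multiset.count c) h
    simp only [Multiset.count_map, eq_comm (a := c)] at this
    exact this
  refine ⟨(Equiv.sigmaFiberEquiv z).symm.trans
    ((Equiv.sigmaCongrRight fun c => (hcard c).some).trans (Equiv.sigmaFiberEquiv w)), ?_⟩
  ext i
  exact ((hcard (z i)).some ⟨i, rfl⟩).2.symm

section

variable {n : ℕ} {A B : Matrix (Fin n) (Fin n) ℂ}

theorem multisetSpectrum_eq_map_iff_charpoly_eq {M : Matrix (Fin n) (Fin n) ℂ} {z : Fin n → ℂ} :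
    multisetSpectrum M = Finset.univ.val.map z ↔
      M.charpoly = ∏ j, (Polynomial.X - Polynomial.C (z j)) := by
  have hprod : ∏ j, (Polynomial.X - Polynomial.C (z j)) =
      ((Finset.univ.val.map z).map fun a => Polynomial.X - Polynomial.C a).prod := by
    rw [Multiset.map_map]; rfl
  constructor
  · intro h
    rw [hprod, ← h]
    exact (IsAlgClosed.splits _).eq_prod_roots_of_monic M.charpoly_monic
  · intro h
    rw [multisetSpectrum, h, hprod, Polynomial.roots_multiset_prod_X_sub_C]

/-- Pointwise determinant identities pass to limits, unlike root multisets handled directly. -/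
theorem multisetSpectrum_eq_map_iff {M : Matrix (Fin n) (Fin n) ℂ} {z : Fin n → ℂ} :
    multisetSpectrum M = Finset.univ.val.map z ↔
      ∀ x : ℂ, (Matrix.scalar (Fin n) x - M).det = ∏ j, (x - z j) := by
  rw [multisetSpectrum_eq_map_iff_charpoly_eq]
  constructor
  · intro h x
    rw [← Matrix.eval_charpoly, h]
    simp [Polynomial.eval_prod]
  · intro h
    refine Polynomial.funext fun x => ?_
    rw [Matrix.eval_charpoly, h]
    simp [Polynomial.eval_prod]

theorem exists_multisetSpectrum_eq_map (M : Matrix (Fin n) (Fin n) ℂ) :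
    ∃ z : Fin n → ℂ, multisetSpectrum M = Finset.univ.val.map z := by
  have hcard : (multisetSpectrum M).toList.length = n := by
    rw [Multiset.length_toList, multisetSpectrum, ← (IsAlgClosed.splits _).natDegree_eq_card_roots,
      Matrix.charpoly_natDegree_eq_dim, Fintype.card_fin]
  refine ⟨fun j => (multisetSpectrum M).toList.get (j.cast hcard.symm), ?_⟩
  rw [Fin.univ_val_map, ← List.ofFn_congr hcard, List.ofFn_get, Multiset.coe_toList]

theorem multisetSpectrum_smul {M : Matrix (Fin n) (Fin n) ℂ} {z : Fin n → ℂ}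
    (h : multisetSpectrum M = Finset.univ.val.map z) (r : ℂ) :
    multisetSpectrum (r • M) = Finset.univ.val.map fun j => r * z j := by
  rw [multisetSpectrum_eq_map_iff] at h ⊢
  intro x
  rcases eq_or_ne r 0 with rfl | hr
  · simp
  · have : Matrix.scalar (Fin n) x - r • M = r • (Matrix.scalar (Fin n) (x / r) - M) := by
      ext i j
      by_cases hij : i = j <;> simp [hij, mul_sub, mul_div_cancel₀, hr]
    rw [this, Matrix.det_smul, h, Fintype.card_fin, ← Fin.prod_const, ← Finset.prod_mul_distrib]
    exact Finset.prod_congr rfl fun j _ => by field_simp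

/-- Eigenvalues are bounded by an operator norm, which is bounded on the compact interval. The
factor `‖1‖` covers `n = 0`, where it vanishes. -/
theorem exists_bound_of_multisetSpectrum_eq_map (C : Path A B) :
    ∃ K : ℝ, ∀ t : I, ∀ z : Fin n → ℂ, multisetSpectrum (C t) = Finset.univ.val.map z →
      z ∈ Metric.closedBall 0 K := by
  let _ : NormedRing (Matrix (Fin n) (Fin n) ℂ) := Matrix.linftyOpNormedRing
  let _ : NormedAlgebra ℂ (Matrix (Fin n) (Fin n) ℂ) := Matrix.linftyOpNormedAlgebra
  have hcont : Continuous fun t : I => ‖C t‖ * ‖(1 : Matrix (Fin n) (Fin n) ℂ)‖ :=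
    (continuous_norm.comp C.continuous).mul continuous_const
  obtain ⟨K, hK⟩ := (isCompact_range hcont).bddAbove
  refine ⟨K, fun t z hz => ?_⟩
  have hKt := hK (Set.mem_range_self t)
  rw [mem_closedBall_zero_iff, pi_norm_le_iff_of_nonneg ((by positivity : 0 ≤ ‖C t‖ * ‖(1 : Matrix (Fin n) (Fin n) ℂ)‖).trans hKt)]
  intro j
  refine (spectrum.norm_le_norm_mul_of_mem ?_).trans hKt
  rw [Matrix.mem_spectrum_iff_isRoot_charpoly, Polynomial.IsRoot, Matrix.eval_charpoly,
    multisetSpectrum_eq_map_iff.mp hz]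
  exact Finset.prod_eq_zero (Finset.mem_univ j) (sub_self _)

theorem multisetSpectrum_eq_map_of_tendsto {ι : Type*} {l : Filter ι} [l.NeBot]
    {M : ι → Matrix (Fin n) (Fin n) ℂ} {M₀ : Matrix (Fin n) (Fin n) ℂ}
    {z : ι → Fin n → ℂ} {z₀ : Fin n → ℂ} (hM : Tendsto M l (𝓝 M₀)) (hz : Tendsto z l (𝓝 z₀))
    (h : ∀ i, multisetSpectrum (M i) = Finset.univ.val.map (z i)) :
    multisetSpectrum M₀ = Finset.univ.val.map z₀ := by
  rw [multisetSpectrum_eq_map_iff]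
  intro x
  have h1 : Tendsto (fun i => (Matrix.scalar (Fin n) x - M i).det) l
      (𝓝 (Matrix.scalar (Fin n) x - M₀).det) :=
    ((by fun_prop : Continuous fun N : Matrix (Fin n) (Fin n) ℂ =>
      (Matrix.scalar (Fin n) x - N).det).tendsto M₀).comp hM
  have h2 : Tendsto (fun i => ∏ j, (x - z i j)) l (𝓝 (∏ j, (x - z₀ j))) :=
    ((by fun_prop : Continuous fun w : Fin n → ℂ => ∏ j, (x - w j)).tendsto z₀).comp hz
  refine tendsto_nhds_unique h1 (h2.congr fun i => ?_)
  rw [multisetSpectrum_eq_map_iff.mp (h i)]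

/-- Eigenvalue vectors along a matrix path vary uniformly continuously, up to reordering. -/
theorem exists_delta_dist_eigenvalues_lt (C : Path A B) {ε : ℝ} (hε : 0 < ε) :
    ∃ δ > 0, ∀ s t : I, dist s t < δ →
      ∀ x : Fin n → ℂ, multisetSpectrum (C s) = Finset.univ.val.map x →
        ∃ y : Fin n → ℂ, multisetSpectrum (C t) = Finset.univ.val.map y ∧ dist x y < ε := by
  by_contra! hcon
  choose s t hst x hx hfar using fun k : ℕ =>
    hcon (1 / ((k : ℝ) + 1)) (by positivity)
  choose y hy using fun k => exists_multisetSpectrum_eq_map (C (t k))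
  obtain ⟨K, hK⟩ := exists_bound_of_multisetSpectrum_eq_map C
  let U : Ultrafilter ℕ := hyperfilter ℕ
  have hU : (U : Filter ℕ) ≤ atTop := Nat.hyperfilter_le_atTop
  have hball : IsCompact (Metric.closedBall (0 : Fin n → ℂ) K) := isCompact_closedBall _ _
  obtain ⟨s₀, -, hs₀⟩ := isCompact_univ.ultrafilter_le_nhds (U.map s) (by simp)
  obtain ⟨x₀, -, hx₀⟩ := hball.ultrafilter_le_nhds (U.map x)
    (tendsto_principal.mpr (Eventually.of_forall fun k => hK _ _ (hx k)))
  obtain ⟨y₀, -, hy₀⟩ := hball.ultrafilter_le_nhds (U.map y)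
    (tendsto_principal.mpr (Eventually.of_forall fun k => hK _ _ (hy k)))
  replace hs₀ : Tendsto s U (𝓝 s₀) := hs₀
  replace hx₀ : Tendsto x U (𝓝 x₀) := hx₀
  replace hy₀ : Tendsto y U (𝓝 y₀) := hy₀
  have ht₀ : Tendsto t U (𝓝 s₀) := by
    refine hs₀.congr_dist (squeeze_zero (fun _ => dist_nonneg) (fun k => (hst k).le) ?_)
    exact (tendsto_one_div_add_atTop_nhds_zero_nat (𝕜 := ℝ)).mono_left hU
  have hxs := multisetSpectrum_eq_map_of_tendsto ((C.continuous.tendsto s₀).comp hs₀) hx₀ hx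
  have hys := multisetSpectrum_eq_map_of_tendsto ((C.continuous.tendsto s₀).comp ht₀) hy₀ hy
  -- Both limits list the spectrum of `C s₀`, so reordering the `y k` by this fixed `τ` brings them
  -- close to the `x k`.
  obtain ⟨τ, rfl⟩ := exists_perm_comp_eq_of_map_univ_eq (hxs.symm.trans hys)
  have hyτ : Tendsto (fun k => y k ∘ τ) U (𝓝 (y₀ ∘ τ)) :=
    ((by fun_prop : Continuous fun w : Fin n → ℂ => w ∘ τ).tendsto y₀).comp hy₀
  obtain ⟨k, hk⟩ := ((by simpa using hx₀.dist hyτ :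
    Tendsto (fun k => dist (x k) (y k ∘ τ)) U (𝓝 0)).eventually_lt_const hε).exists
  refine hk.not_ge (hfar k _ ?_)
  rw [hy k, ← Multiset.map_map, Multiset.map_univ_val_equiv]

/-- Every matrix path has an eigenpath set with any prescribed ordering of the eigenvalues at its
source. -/
theorem exists_isEigenpathSet (C : Path A B) {z : Fin n → ℂ}
    (hz : multisetSpectrum A = Finset.univ.val.map z) :
    ∃ γ : Fin n → C(I, ℂ), IsEigenpathSet C γ ∧ ∀ j, γ j 0 = z j := by
  obtain ⟨γ, hγ0, hγ⟩ := exists_continuous_selection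
    (fun t => {w : Fin n → ℂ | multisetSpectrum (C t) = Finset.univ.val.map w})
    (fun t => by
      obtain ⟨w, hw⟩ := exists_multisetSpectrum_eq_map (C t)
      refine (Set.finite_range fun τ : Equiv.Perm (Fin n) => w ∘ τ).subset fun v hv => ?_
      obtain ⟨τ, rfl⟩ := exists_perm_comp_eq_of_map_univ_eq (hv.symm.trans hw)
      exact ⟨τ, rfl⟩)
    (fun ε hε => exists_delta_dist_eigenvalues_lt C hε)
    (x₀ := z) (by simpa using hz)
  exact ⟨fun j => ⟨fun t => γ t j, by fun_prop⟩, hγ, fun j => congrFun hγ0 j⟩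

/-! ### Homogeneous extension to a quadrant -/

/-- The degree-one homogeneous extension to the closed first quadrant of a function on the segment
between `(1, 0)` and `(0, 1)`. -/
noncomputable def homogeneousExtension (c : C(I, ℂ)) (u v : ℝ) : ℂ :=
  ((u + v : ℝ) : ℂ) * c (Set.projIcc 0 1 zero_le_one (v / (u + v)))

theorem homogeneousExtension_zero_right (c : C(I, ℂ)) (u : ℝ) :
    homogeneousExtension c u 0 = u * c 0 := by
  simp [homogeneousExtension]

theorem homogeneousExtension_zero_left (c : C(I, ℂ)) (v : ℝ) :
    homogeneousExtension c 0 v = v * c 1 := by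
  rcases eq_or_ne v 0 with rfl | hv
  · simp [homogeneousExtension]
  · simp [homogeneousExtension, hv]

theorem continuous_homogeneousExtension_comp {X : Type*} [TopologicalSpace X] (c : C(I, ℂ))
    {u v : X → ℝ} (hu : Continuous u) (hv : Continuous v) :
    Continuous fun x => homogeneousExtension c (u x) (v x) := by
  rw [continuous_iff_continuousAt]
  intro x₀
  have hsum : ContinuousAt (fun x => ((u x + v x : ℝ) : ℂ)) x₀ := by fun_prop
  by_cases h : u x₀ + v x₀ = 0
  · obtain ⟨K, hK⟩ := (isCompact_range c.continuous).isBounded.exists_norm_le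
    have hlim : Tendsto (fun x => ((u x + v x : ℝ) : ℂ)) (𝓝 x₀) (𝓝 0) := by
      simpa [ContinuousAt, ← Complex.ofReal_add, h] using hsum
    have h0 : homogeneousExtension c (u x₀) (v x₀) = 0 := by simp [homogeneousExtension, h]
    rw [ContinuousAt, h0]
    exact hlim.zero_mul_isBoundedUnder_le
      (isBoundedUnder_of ⟨K, fun x => hK _ (Set.mem_range_self _)⟩)
  · refine hsum.mul (c.continuous.continuousAt.comp (continuous_projIcc.continuousAt.comp ?_))
    exact hv.continuousAt.div (hu.add hv).continuousAt h

theorem multisetSpectrum_eq_map_homogeneousExtension {c : Fin n → C(I, ℂ)}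
    (hc : IsEigenpathSet (convexPath A B) c) {u v : ℝ} (hu : 0 ≤ u) (hv : 0 ≤ v) :
    multisetSpectrum (u • A + v • B) =
      Finset.univ.val.map fun j => homogeneousExtension (c j) u v := by
  have key := multisetSpectrum_smul (hc (Set.projIcc 0 1 zero_le_one (v / (u + v))))
    ((u + v : ℝ) : ℂ)
  have hmem : v / (u + v) ∈ Set.Icc (0 : ℝ) 1 :=
    ⟨by positivity, div_le_one_of_le₀ (by linarith) (by positivity)⟩
  suffices h : ((u + v : ℝ) : ℂ) •
      convexPath A B (Set.projIcc 0 1 zero_le_one (v / (u + v))) = u • A + v • B by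
    rw [h] at key
    exact key
  rw [Complex.coe_smul, Set.projIcc_of_mem zero_le_one hmem]
  change (u + v) • ((1 - v / (u + v)) • A + (v / (u + v)) • B) = _
  rcases (add_nonneg hu hv).eq_or_lt with h | h
  · obtain ⟨rfl, rfl⟩ := (add_eq_zero_iff_of_nonneg hu hv).mp h.symm
    simp
  · rw [smul_add, smul_smul, smul_smul, mul_sub, mul_div_cancel₀ _ h.ne']
    simp

end

/-! ### Gluing the three quadrants -/

theorem theorem3 (n : ℕ) (A B : Matrix (Fin n) (Fin n) ℂ) (f g : C(I, ℝ))
    (hf0 : f 0 = 1) (hg1 : g 1 = 1) (hf1 : f 1 = 0) (hg0 : g 0 = 0)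
    (hfg : ∀ α : I, 0 ≤ (f ⊔ g) α)
    (p : multisetSpectrum A ≃ multisetSpectrum B)
    (hp : IsEigenpairing (convexPath A B) p) :
    IsEigenpairing (combinationPath A B f g hf0 hg1 hf1 hg0) p := by
  obtain ⟨c, hc, e, he⟩ := hp
  obtain ⟨a, ha, ha0⟩ := exists_isEigenpathSet (convexPath A (-B)) (z := fun j => c j 0)
    (by simpa using hc 0)
  obtain ⟨b, hb, hb0⟩ := exists_isEigenpathSet (convexPath B (-A)) (z := fun j => c j 1)
    (by simpa using hc 1)
  -- the second and third terms vanish unless `g`, respectively `f`, is negative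
  let γ (j : Fin n) (α : I) : ℂ := homogeneousExtension (c j) (f α ⊔ 0) (g α ⊔ 0) +
    (homogeneousExtension (a j) (f α ⊔ 0) (-g α ⊔ 0) - ((f α ⊔ 0 : ℝ) : ℂ) * c j 0) +
    (homogeneousExtension (b j) (g α ⊔ 0) (-f α ⊔ 0) - ((g α ⊔ 0 : ℝ) : ℂ) * c j 1)
  have hγ (j : Fin n) : Continuous (γ j) := by
    have h1 := continuous_homogeneousExtension_comp (c j)
      (by fun_prop : Continuous fun α => f α ⊔ 0) (by fun_prop : Continuous fun α => g α ⊔ 0)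
    have h2 := continuous_homogeneousExtension_comp (a j)
      (by fun_prop : Continuous fun α => f α ⊔ 0) (by fun_prop : Continuous fun α => -g α ⊔ 0)
    have h3 := continuous_homogeneousExtension_comp (b j)
      (by fun_prop : Continuous fun α => g α ⊔ 0) (by fun_prop : Continuous fun α => -f α ⊔ 0)
    exact (h1.add (h2.sub (by fun_prop))).add (h3.sub (by fun_prop))
  refine ⟨fun j => ⟨γ j, hγ j⟩, fun α => ?_, e, fun j => ⟨?_, ?_⟩⟩
  · change multisetSpectrum (f α • A + g α • B) = Finset.univ.val.map fun j => γ j α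
    rcases le_or_gt 0 (f α) with hf | hf
    · rcases le_or_gt 0 (g α) with hg | hg
      · rw [multisetSpectrum_eq_map_homogeneousExtension hc hf hg]
        simp [γ, hf, hg, homogeneousExtension_zero_right, ha0, hb0]
      · have := multisetSpectrum_eq_map_homogeneousExtension ha hf (neg_nonneg.mpr hg.le)
        rw [smul_neg, neg_smul, neg_neg] at this
        rw [this]
        simp [γ, hf, hg.le, homogeneousExtension_zero_right]
    · have hg : 0 ≤ g α := (le_sup_iff.mp (hfg α)).resolve_left hf.not_ge
      have := multisetSpectrum_eq_map_homogeneousExtension hb hg (neg_nonneg.mpr hf.le)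
      rw [smul_neg, neg_smul, neg_neg, add_comm] at this
      rw [this]
      simp [γ, hg, hf.le, homogeneousExtension_zero_right, homogeneousExtension_zero_left]
  · change γ j 0 = _
    simp [γ, hf0, hg0, homogeneousExtension_zero_right, ha0, (he j).1]
  · change γ j 1 = _
    simp [γ, hf1, hg1, homogeneousExtension_zero_right, homogeneousExtension_zero_left, hb0,
      (he j).2]
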